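/- Let $1<q<p<\infty$, and write $p'=\frac{p}{p-1}$, $q'=\frac{q}{q-1}$. There is a constant $C<\infty$ depending only on $p$ and $q$ such that the following holds. Let $d\ge 1$, let $\sigma,\omega$ be locally finite Borel measures on $\mathbb{R}^d$, let $\mathcal D$ be the collection of all half-open dyadic cubes $\prod_{i=1}^d[m_i2^k,(m_i+1)2^k)$, $k\in\mathbb Z$, $m\in\mathbb Z^d$, and let $\{\lambda_Q\}_{Q\in\mathcal D}$ be non-negative reals such that $\lambda_Q\,\omega(Q)=0$ whenever $\sigma(Q)=0$. For a measure $\mu$, a function $f$ and a family $a=\{a_Q\}$ with values in $[0,\infty]$ put $$\langle f\rangle^\mu_Q=\frac1{\mu(Q)}\int_Q|f|\,d\mu,\qquad T_a(f\mu)=\sum_{Q\in\mathcal D}a_Q\langle f\rangle^\mu_Q1_Q,\qquad M_a(f\mu)=\sup_{Q\in\mathcal D}a_Q\langle f\rangle^\mu_Q1_Q,$$ with the conventions $\frac00=0$, $\frac{t}{0}=\infty$ for $0<t<\infty$, and $0\cdot\infty=0$. For an operator $T$ let $\|T\|_{L^r(\mu)\to L^s(\nu)}\in[0,\infty]$ be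 the least constant $A$ such that $\|Tf\|_{L^s(\nu)}\le A\|f\|_{L^r(\mu)}$ for all $f\in L^r(\mu)$. Let $$\Lambda_Q=\frac1{\omega(Q)}\sum_{R\in\mathcal D,\,R\subseteq Q}\lambda_R\,\omega(R).$$ Then $$C^{-1}\,\|T_\lambda(\cdot\,\sigma)\|_{L^p(\sigma)\to L^q(\omega)}\le\|M_{\{\Lambda_Q\}}(\cdot\,\sigma)\|_{L^p(\sigma)\to L^q(\omega)}+\big\|M_{\{\frac{\omega(Q)}{\sigma(Q)}\Lambda_Q\}}(\cdot\,\omega)\big\|_{L^{q'}(\omega)\to L^{p'}(\sigma)}\le C\,\|T_\lambda(\cdot\,\sigma)\|_{L^p(\sigma)\to L^q(\omega)}.$$ In particular, the norm inequality for $T_\lambda(\cdot\,\sigma)$ holds with some finite constant if and only if the norm inequalities for both maximal operators hold with some finite constants. -/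

import Mathlib

open MeasureTheory
open scoped ENNReal NNReal

namespace TwoWeight

/-- `Q ⊆ ℝ^d` is a (half-open) dyadic cube: `Q = ∏ᵢ [mᵢ 2^k, (mᵢ + 1) 2^k)` with `k ∈ ℤ`, `m ∈ ℤ^d`.
The space `ℝ^d` is modelled by `Fin d → ℝ`; only its topology and Borel sets are used. -/
def IsDyadicCube {d : ℕ} (Q : Set (Fin d → ℝ)) : Prop :=
  ∃ (k : ℤ) (m : Fin d → ℤ),
    Q = Set.univ.pi fun i => Set.Ico ((m i : ℝ) * 2 ^ k) (((m i : ℝ) + 1) * 2 ^ k)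

/-- The collection of all dyadic cubes in `ℝ^d`. -/
abbrev DyadicCube (d : ℕ) : Type := {Q : Set (Fin d → ℝ) // IsDyadicCube Q}

variable {d : ℕ}

/-- The average `⟨f⟩_Q^μ = μ(Q)⁻¹ ∫_Q |f| dμ`, an extended non-negative real. Division in `ℝ≥0∞`
satisfies `0 / 0 = 0`, so the average is `0` on a cube of measure zero. -/
noncomputable def average (μ : Measure (Fin d → ℝ)) (f : (Fin d → ℝ) → ℝ)
    (Q : DyadicCube d) : ℝ≥0∞ :=
  (∫⁻ x in (Q : Set (Fin d → ℝ)), ‖f x‖ₑ ∂μ) / μ Q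

/-- The dyadic summation operator `T_a(f μ) = ∑_Q a_Q ⟨f⟩_Q^μ 1_Q`. -/
noncomputable def sumOp (a : DyadicCube d → ℝ≥0∞) (μ : Measure (Fin d → ℝ))
    (f : (Fin d → ℝ) → ℝ) : (Fin d → ℝ) → ℝ≥0∞ :=
  fun x => ∑' Q : DyadicCube d,
    (Q : Set (Fin d → ℝ)).indicator (fun _ => a Q * average μ f Q) x

/-- The dyadic maximal operator `M_a(f μ) = sup_Q a_Q ⟨f⟩_Q^μ 1_Q`. -/
noncomputable def maxOp (a : DyadicCube d → ℝ≥0∞) (μ : Measure (Fin d → ℝ))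
    (f : (Fin d → ℝ) → ℝ) : (Fin d → ℝ) → ℝ≥0∞ :=
  fun x => ⨆ Q : DyadicCube d,
    (Q : Set (Fin d → ℝ)).indicator (fun _ => a Q * average μ f Q) x

/-- The norm inequality `‖T f‖_{L^s(ν)} ≤ C ‖f‖_{L^r(μ)}` for all `f ∈ L^r(μ)`. -/
def NormIneq (r s : ℝ) (μ ν : Measure (Fin d → ℝ))
    (T : ((Fin d → ℝ) → ℝ) → (Fin d → ℝ) → ℝ≥0∞) (C : ℝ≥0∞) : Prop :=
  ∀ f : (Fin d → ℝ) → ℝ, MemLp f (ENNReal.ofReal r) μ →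
    eLpNorm (T f) (ENNReal.ofReal s) ν ≤ C * eLpNorm f (ENNReal.ofReal r) μ

/-- `‖T‖_{L^r(μ) → L^s(ν)}`: the least constant in the norm inequality, `∞` if no finite one
exists. -/
noncomputable def opNorm (r s : ℝ) (μ ν : Measure (Fin d → ℝ))
    (T : ((Fin d → ℝ) → ℝ) → (Fin d → ℝ) → ℝ≥0∞) : ℝ≥0∞ :=
  sInf {C : ℝ≥0∞ | NormIneq r s μ ν T C}

/-- `Λ_Q = ω(Q)⁻¹ ∑_{R ⊆ Q} l_R ω(R)`, the sum being over the dyadic cubes `R ⊆ Q`. -/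
noncomputable def bigLambda (l : DyadicCube d → ℝ≥0) (ω : Measure (Fin d → ℝ))
    (Q : DyadicCube d) : ℝ≥0∞ :=
  (∑' R : {R : DyadicCube d // (R : Set (Fin d → ℝ)) ⊆ Q}, (l R : ℝ≥0∞) * ω (R : DyadicCube d)) /
    ω Q

end TwoWeight

namespace TwoWeight

variable {d : ℕ}

/-! Put `c Q = l Q * ω Q`. By duality the summation operator is governed by the form `∑ c Q ⟨h⟩^σ_Q
⟨k⟩^ω_Q`. This form is symmetric under exchanging `(σ, p)` with `(ω, q')`, so each estimate for one
maximal operator yields the one for the other.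

Sum bounded by maxima: on a finite family, replace each average by its supremum over larger cubes
and write that as a sum of `jump`s along the chain of cubes containing `Q`. The product of two such
sums splits according to which of the two cubes is the smaller. Summing first over all `Q` inside
the smaller cube `P` produces `∑_{Q ⊆ P} c Q = ω(P) Λ_P` (`sum_mul_le_sum_jump`). This times the
supremum of the averages of `h` is at most `∫_P M_Λ(M^σ h) dω`, while the jumps of the averages of
`k` add up pointwise to at most `M^ω k`. Hölder and the dyadic maximal theorem
`lpNN_cubeSup_lavg_le` conclude (`sum_subSum_mul_le`).

Maxima bounded by sum: `M^σ h ≥ ⟨h⟩_Q` on `Q`, hence `Λ_Q ⟨h⟩_Q ≤ ⟨T(M^σ h)⟩^ω_Q`, so `M_Λ h ≤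
M^ω(T(M^σ h))` and the maximal theorem applies twice (`lavgIneq_cubeSup_of_cubeSum`). -/

/-! ### Dyadic cubes: countability and nestedness. -/

theorem measurableSet_cube (Q : DyadicCube d) : MeasurableSet (Q : Set (Fin d → ℝ)) := by
  obtain ⟨_, k, m, rfl⟩ := Q
  exact MeasurableSet.univ_pi fun i => measurableSet_Ico

instance countable_dyadicCube : Countable (DyadicCube d) := by
  have h : {Q : Set (Fin d → ℝ) | IsDyadicCube Q} ⊆ Set.range fun z : ℤ × (Fin d → ℤ) =>
      Set.univ.pi fun i => Set.Ico ((z.2 i : ℝ) * 2 ^ z.1) (((z.2 i : ℝ) + 1) * 2 ^ z.1) := by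
    rintro _ ⟨k, m, rfl⟩
    exact ⟨(k, m), rfl⟩
  exact ((Set.countable_range _).mono h).to_subtype

theorem measure_cube_lt_top (μ : Measure (Fin d → ℝ)) [IsLocallyFiniteMeasure μ]
    (Q : DyadicCube d) : μ Q < ⊤ := by
  obtain ⟨_, k, m, rfl⟩ := Q
  refine lt_of_le_of_lt (measure_mono ?_)
    (isCompact_univ_pi fun i => isCompact_Icc (a := (m i : ℝ) * 2 ^ k)
      (b := ((m i : ℝ) + 1) * 2 ^ k)).measure_lt_top
  exact Set.pi_mono fun i _ => Set.Ico_subset_Icc_self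

theorem nonempty_cube (Q : DyadicCube d) : (Q : Set (Fin d → ℝ)).Nonempty := by
  obtain ⟨_, k, m, rfl⟩ := Q
  refine ⟨fun i => (m i : ℝ) * 2 ^ k, fun i _ => ⟨le_rfl, ?_⟩⟩
  have : (0 : ℝ) < 2 ^ k := by positivity
  nlinarith

/-- In units of `2 ^ k` both intervals have integer endpoints. A common point gives strict
inequalities between integers, and these sharpen to the containment. -/
theorem Ico_subset_Ico_of_scale_le {k k' m m' : ℤ} (hk : k ≤ k') {x : ℝ}
    (h : x ∈ Set.Ico ((m : ℝ) * 2 ^ k) ((m + 1) * 2 ^ k))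
    (h' : x ∈ Set.Ico ((m' : ℝ) * 2 ^ k') ((m' + 1) * 2 ^ k')) :
    Set.Ico ((m : ℝ) * 2 ^ k) ((m + 1) * 2 ^ k) ⊆
      Set.Ico ((m' : ℝ) * 2 ^ k') ((m' + 1) * 2 ^ k') := by
  obtain ⟨n, rfl⟩ := Int.le.dest hk
  have h2 : (0 : ℝ) < 2 ^ k := by positivity
  have e : (2 : ℝ) ^ (k + (n : ℤ)) = ((2 ^ n : ℤ) : ℝ) * 2 ^ k := by
    rw [zpow_add₀ two_ne_zero]; push_cast; rw [zpow_natCast, mul_comm]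
  rw [e, ← mul_assoc, ← mul_assoc] at h' ⊢
  have h1 : (m' : ℝ) * ((2 ^ n : ℤ) : ℝ) < m + 1 := lt_of_mul_lt_mul_right (h'.1.trans_lt h.2) h2.le
  have h3 : (m : ℝ) < (m' + 1) * ((2 ^ n : ℤ) : ℝ) :=
    lt_of_mul_lt_mul_right (h.1.trans_lt h'.2) h2.le
  have h4 : m' * 2 ^ n ≤ m := by
    have : m' * 2 ^ n < m + 1 := by exact_mod_cast h1
    omega
  have h5 : m + 1 ≤ (m' + 1) * 2 ^ n := by
    have : m < (m' + 1) * 2 ^ n := by exact_mod_cast h3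
    omega
  refine Set.Ico_subset_Ico (mul_le_mul_of_nonneg_right ?_ h2.le)
    (mul_le_mul_of_nonneg_right ?_ h2.le)
  · exact_mod_cast h4
  · exact_mod_cast h5

theorem cube_le_or_le {Q R : DyadicCube d} {x : Fin d → ℝ} (hQ : x ∈ (Q : Set (Fin d → ℝ)))
    (hR : x ∈ (R : Set (Fin d → ℝ))) : Q ≤ R ∨ R ≤ Q := by
  obtain ⟨_, k, m, rfl⟩ := Q
  obtain ⟨_, k', m', rfl⟩ := R
  rcases le_total k k' with h | h
  · exact Or.inl (Set.pi_mono fun i hi => Ico_subset_Ico_of_scale_le h (hQ i hi) (hR i hi))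
  · exact Or.inr (Set.pi_mono fun i hi => Ico_subset_Ico_of_scale_le h (hR i hi) (hQ i hi))

theorem le_or_le_of_le {P Q R : DyadicCube d} (hQ : P ≤ Q) (hR : P ≤ R) : Q ≤ R ∨ R ≤ Q :=
  let ⟨_, hx⟩ := nonempty_cube P
  cube_le_or_le (hQ hx) (hR hx)

/-! ### Jumps along chains, and summation by parts for products. -/

section Jump

open scoped Classical in
/-- The amount by which `f P` exceeds all values of `f` at strictly larger elements of `S`. -/
noncomputable def jump {ι : Type*} [PartialOrder ι] (S : Finset ι) (f : ι → ℝ≥0∞) (P : ι) :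
    ℝ≥0∞ :=
  f P - (S.filter (P < ·)).sup f

-- Telescoping, by removing the least element `m` of the chain. As `U` is upward closed in `S`, the
-- rest of `U` is exactly what lies above `m`, and truncated subtraction gives `(f m - s) + s = max
-- (f m) s`.
open scoped Classical in
theorem sum_jump_eq_sup {ι : Type*} [PartialOrder ι] (S U : Finset ι) (f : ι → ℝ≥0∞)
    (hU : ∀ P ∈ U, ∀ R ∈ S, P < R → R ∈ U) (hUS : U ⊆ S)
    (hc : ∀ P ∈ U, ∀ R ∈ U, P ≤ R ∨ R ≤ P) :
    ∑ P ∈ U, jump S f P = U.sup f := by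
  induction hn : U.card generalizing U with
  | zero => simp [Finset.card_eq_zero.mp hn]
  | succ n ih =>
    obtain ⟨m, hm⟩ := U.exists_minimal (Finset.card_pos.mp (by omega))
    have hmU := hm.1
    have least : ∀ P ∈ U, m ≤ P := fun P hP => (hc m hmU P hP).elim id fun h => hm.2 hP h
    have e1 : S.filter (m < ·) = U.erase m := by
      ext R
      simp only [Finset.mem_filter, Finset.mem_erase]
      exact ⟨fun h => ⟨h.2.ne', hU m hmU R h.1 h.2⟩,
        fun h => ⟨hUS h.2, lt_of_le_of_ne (least R h.2) h.1.symm⟩⟩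
    have key := ih (U.erase m)
      (fun P hP R hR h => Finset.mem_erase.mpr
        ⟨((least P (Finset.mem_of_mem_erase hP)).trans_lt h).ne',
          hU P (Finset.mem_of_mem_erase hP) R hR h⟩)
      ((Finset.erase_subset _ _).trans hUS)
      (fun P hP R hR => hc P (Finset.mem_of_mem_erase hP) R (Finset.mem_of_mem_erase hR))
      (by rw [Finset.card_erase_of_mem hmU, hn]; rfl)
    rw [← Finset.add_sum_erase U _ hmU, key, jump, e1, tsub_add_eq_max]
    conv_rhs => rw [← Finset.insert_erase hmU, Finset.sup_insert]

end Jump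

open scoped Classical in
theorem sum_jump_of_mem (S : Finset (DyadicCube d)) (f : DyadicCube d → ℝ≥0∞) (x : Fin d → ℝ) :
    ∑ P ∈ S, (P : Set (Fin d → ℝ)).indicator (fun _ => jump S f P) x =
      (S.filter (fun P : DyadicCube d => x ∈ (P : Set (Fin d → ℝ)))).sup f := by
  rw [← sum_jump_eq_sup S, Finset.sum_filter]
  · rfl
  · intro P hP R hR h
    simp only [Finset.mem_filter] at hP ⊢
    exact ⟨hR, h.le hP.2⟩
  · exact Finset.filter_subset _ _
  · intro P hP R hR
    simp only [Finset.mem_filter] at hP hR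
    exact cube_le_or_le hP.2 hR.2

open scoped Classical in
theorem sum_jump_of_le (S : Finset (DyadicCube d)) (f : DyadicCube d → ℝ≥0∞) (Q : DyadicCube d) :
    ∑ P ∈ S.filter (Q ≤ ·), jump S f P = (S.filter (Q ≤ ·)).sup f := by
  apply sum_jump_eq_sup
  · intro P hP R hR h
    simp only [Finset.mem_filter] at hP ⊢
    exact ⟨hR, hP.2.trans h.le⟩
  · exact Finset.filter_subset _ _
  · intro P hP R hR
    simp only [Finset.mem_filter] at hP hR
    exact le_or_le_of_le hP.2 hR.2

open scoped Classical in
theorem mul_le_sum_jump (S : Finset (DyadicCube d)) (f g : DyadicCube d → ℝ≥0∞)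
    {Q : DyadicCube d} (hQ : Q ∈ S) :
    f Q * g Q ≤ ∑ P ∈ S.filter (Q ≤ ·),
      (jump S f P * (S.filter (P ≤ ·)).sup g + (S.filter (P ≤ ·)).sup f * jump S g P) := by
  have hQ' : Q ∈ S.filter (Q ≤ ·) := by simp [hQ]
  set U := S.filter (Q ≤ ·) with hU
  calc f Q * g Q ≤ U.sup f * U.sup g :=
        mul_le_mul' (Finset.le_sup hQ') (Finset.le_sup hQ')
    _ = ∑ P ∈ U, ∑ R ∈ U, jump S f P * jump S g R := by
        rw [← sum_jump_of_le S f Q, ← sum_jump_of_le S g Q, Finset.sum_mul_sum]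
    -- `U` is a chain, so each pair falls in at least one half; the diagonal is counted twice, which
    -- an upper bound allows.
    _ ≤ ∑ P ∈ U, ∑ R ∈ U, ((if P ≤ R then jump S f P * jump S g R else 0) +
          if R ≤ P then jump S f P * jump S g R else 0) := by
        refine Finset.sum_le_sum fun P hP => Finset.sum_le_sum fun R hR => ?_
        rcases le_or_le_of_le (Finset.mem_filter.mp hP).2 (Finset.mem_filter.mp hR).2 with h | h
        · simp [h]
        · simp [h]
    _ = ∑ P ∈ U, ((∑ R ∈ U, if P ≤ R then jump S f P * jump S g R else 0) +
          ∑ R ∈ U, if P ≤ R then jump S f R * jump S g P else 0) := by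
        simp only [Finset.sum_add_distrib]
        congr 1
        exact Finset.sum_comm
    _ ≤ _ := by
        refine Finset.sum_le_sum fun P hP => ?_
        rw [← sum_jump_of_le S g P, ← sum_jump_of_le S f P, Finset.mul_sum, Finset.sum_mul,
          ← Finset.sum_filter, ← Finset.sum_filter]
        have : U.filter (P ≤ ·) ⊆ S.filter (P ≤ ·) :=
          Finset.filter_subset_filter _ (Finset.filter_subset _ _)
        exact add_le_add (Finset.sum_le_sum_of_subset this) (Finset.sum_le_sum_of_subset this)

open scoped Classical in
theorem sum_mul_le_sum_jump (S : Finset (DyadicCube d)) (c f g : DyadicCube d → ℝ≥0∞) :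
    ∑ Q ∈ S, c Q * (f Q * g Q) ≤ ∑ P ∈ S, (∑ Q ∈ S.filter (· ≤ P), c Q) *
      (jump S f P * (S.filter (P ≤ ·)).sup g + (S.filter (P ≤ ·)).sup f * jump S g P) := by
  calc ∑ Q ∈ S, c Q * (f Q * g Q) ≤ ∑ Q ∈ S, c Q * ∑ P ∈ S.filter (Q ≤ ·),
      (jump S f P * (S.filter (P ≤ ·)).sup g + (S.filter (P ≤ ·)).sup f * jump S g P) :=
        Finset.sum_le_sum fun Q hQ => mul_le_mul_right (mul_le_sum_jump S f g hQ) _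
    _ = _ := by
        simp only [Finset.mul_sum, Finset.sum_mul, Finset.sum_filter]
        rw [Finset.sum_comm]
        simp only [ite_mul, mul_ite, zero_mul, mul_zero]

/-! ### Norms, averages and functions built from cubes. -/

/-- The `L^r(μ)` norm of an extended non-negative function. -/
noncomputable def lpNN (r : ℝ) (μ : Measure (Fin d → ℝ)) (h : (Fin d → ℝ) → ℝ≥0∞) : ℝ≥0∞ :=
  (∫⁻ x, h x ^ r ∂μ) ^ (1 / r)

/-- The average of an extended non-negative function over a cube. -/
noncomputable def lavg (μ : Measure (Fin d → ℝ)) (h : (Fin d → ℝ) → ℝ≥0∞) (Q : DyadicCube d) :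
    ℝ≥0∞ :=
  (∫⁻ x in (Q : Set (Fin d → ℝ)), h x ∂μ) / μ Q

/-- The pointwise supremum of the coefficients of the cubes containing a point. -/
noncomputable def cubeSup (u : DyadicCube d → ℝ≥0∞) (x : Fin d → ℝ) : ℝ≥0∞ :=
  ⨆ Q : DyadicCube d, (Q : Set (Fin d → ℝ)).indicator (fun _ => u Q) x

/-- The pointwise sum of the coefficients of the cubes containing a point. -/
noncomputable def cubeSum (u : DyadicCube d → ℝ≥0∞) (x : Fin d → ℝ) : ℝ≥0∞ :=
  ∑' Q : DyadicCube d, (Q : Set (Fin d → ℝ)).indicator (fun _ => u Q) x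

theorem measurable_indicator_cube (Q : DyadicCube d) (a : ℝ≥0∞) :
    Measurable ((Q : Set (Fin d → ℝ)).indicator fun _ => a) :=
  measurable_const.indicator (measurableSet_cube Q)

theorem measurable_cubeSup (u : DyadicCube d → ℝ≥0∞) : Measurable (cubeSup u) :=
  Measurable.iSup fun Q => measurable_indicator_cube Q _

theorem measurable_cubeSum (u : DyadicCube d → ℝ≥0∞) : Measurable (cubeSum u) :=
  Measurable.tsum fun Q => measurable_indicator_cube Q _

theorem le_cubeSup (u : DyadicCube d → ℝ≥0∞) {Q : DyadicCube d} {x : Fin d → ℝ}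
    (hx : x ∈ (Q : Set (Fin d → ℝ))) : u Q ≤ cubeSup u x :=
  (Set.indicator_of_mem hx fun _ => u Q).symm.le.trans
    (le_iSup (fun Q : DyadicCube d => (Q : Set (Fin d → ℝ)).indicator (fun _ => u Q) x) Q)

theorem lpNN_mono {r : ℝ} (hr : 0 < r) {μ : Measure (Fin d → ℝ)} {h k : (Fin d → ℝ) → ℝ≥0∞}
    (hk : ∀ x, h x ≤ k x) : lpNN r μ h ≤ lpNN r μ k := by
  unfold lpNN
  gcongr
  exact hk _

theorem lpNN_iSup_le {ι : Type*} [Countable ι] [Nonempty ι] [Preorder ι] [IsDirectedOrder ι]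
    {r : ℝ} (hr : 0 < r) {μ : Measure (Fin d → ℝ)} {V : ι → (Fin d → ℝ) → ℝ≥0∞}
    (hm : ∀ i, Measurable (V i)) (hV : Monotone V) {B : ℝ≥0∞} (hB : ∀ i, lpNN r μ (V i) ≤ B) :
    lpNN r μ (fun x => ⨆ i, V i x) ≤ B := by
  have h1 : ∀ x, (⨆ i, V i x) ^ r = ⨆ i, V i x ^ r := fun x =>
    (ENNReal.orderIsoRpow r hr).map_iSup fun i => V i x
  have hr' : 0 < 1 / r := by positivity
  unfold lpNN
  simp_rw [h1]
  rw [lintegral_iSup_directed fun i => ((hm i).pow_const r).aemeasurable]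
  · refine ((ENNReal.orderIsoRpow (1 / r) hr').map_iSup
      fun i => ∫⁻ x, V i x ^ r ∂μ).le.trans (iSup_le hB)
  · refine Monotone.directed_le fun i j hij x => ?_
    exact ENNReal.rpow_le_rpow (hV hij x) hr.le

theorem lintegral_mul_le_lpNN {p q : ℝ} (hpq : p.HolderConjugate q) {μ : Measure (Fin d → ℝ)}
    {h k : (Fin d → ℝ) → ℝ≥0∞} (hh : AEMeasurable h μ) (hk : AEMeasurable k μ) :
    ∫⁻ x, h x * k x ∂μ ≤ lpNN p μ h * lpNN q μ k :=
  ENNReal.lintegral_mul_le_Lp_mul_Lq μ hpq hh hk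

/-- Division by `I ^ (1 / q)` needs `I` finite; this is why the later arguments pass through finite
families of cubes. -/
theorem rpow_inv_le_of_le_mul_rpow_inv {p q : ℝ} (hpq : p.HolderConjugate q) {I K : ℝ≥0∞}
    (hI : I ≠ ⊤) (h : I ≤ K * I ^ (1 / q)) : I ^ (1 / p) ≤ K := by
  rcases eq_or_ne I 0 with rfl | h0
  · simp [hpq.pos]
  · have e : I = I ^ (1 / p) * I ^ (1 / q) := by
      rw [← ENNReal.rpow_add _ _ h0 hI, one_div, one_div, hpq.inv_add_inv_eq_one, ENNReal.rpow_one]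
    nth_rewrite 1 [e] at h
    exact (ENNReal.mul_le_mul_iff_left
      (ENNReal.rpow_pos (pos_iff_ne_zero.mpr h0) hI).ne'
      (ENNReal.rpow_ne_top_of_nonneg (by have := hpq.symm.pos; positivity) hI)).mp h

theorem lpNN_rpow_sub_one {p q : ℝ} (hpq : p.HolderConjugate q) {μ : Measure (Fin d → ℝ)}
    (h : (Fin d → ℝ) → ℝ≥0∞) :
    lpNN q μ (fun x => h x ^ (p - 1)) = (∫⁻ x, h x ^ p ∂μ) ^ (1 / q) := by
  simp only [lpNN, ← ENNReal.rpow_mul, hpq.sub_one_mul_conj]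

/-- Self-improvement: a function with finite `L^p` norm satisfying
`∫ h^p ≤ K ‖h^(p-1)‖_q` has norm at most `K`. -/
theorem lpNN_le_of_lintegral_le {p q : ℝ} (hpq : p.HolderConjugate q) {μ : Measure (Fin d → ℝ)}
    {h : (Fin d → ℝ) → ℝ≥0∞} {K : ℝ≥0∞} (hI : ∫⁻ x, h x ^ p ∂μ ≠ ⊤)
    (hK : ∫⁻ x, h x ^ p ∂μ ≤ K * lpNN q μ fun x => h x ^ (p - 1)) : lpNN p μ h ≤ K :=
  rpow_inv_le_of_le_mul_rpow_inv hpq hI (by rwa [lpNN_rpow_sub_one hpq] at hK)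

/-- For finite `s ≤ u` this is Young's inequality for `u * s ^ (p - 1)` multiplied by `q`, using `q
/ p = q - 1`. It is the increment estimate behind the maximal theorem. -/
theorem rpow_sub_rpow_le {p q : ℝ} (hpq : p.HolderConjugate q) (u s : ℝ≥0∞) :
    u ^ p - s ^ p ≤ ENNReal.ofReal q * (u * (u ^ (p - 1) - s ^ (p - 1))) := by
  have hp := hpq.pos
  have hq := hpq.symm.pos
  rcases le_total u s with h | h
  · simp [tsub_eq_zero_of_le (ENNReal.rpow_le_rpow h hp.le)]
  rcases eq_or_ne s ⊤ with rfl | hs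
  · simp [ENNReal.top_rpow_of_pos hp]
  rcases eq_or_ne u ⊤ with rfl | hu
  · have h1 : (⊤ : ℝ≥0∞) ^ (p - 1) - s ^ (p - 1) = ⊤ := by
      rw [ENNReal.top_rpow_of_pos hpq.sub_one_pos, ENNReal.top_sub]
      exact ENNReal.rpow_ne_top_of_nonneg hpq.sub_one_pos.le hs
    rw [h1, ENNReal.top_mul_top, ENNReal.mul_top (by simpa using hq)]
    exact le_top
  lift s to ℝ≥0 using hs
  lift u to ℝ≥0 using hu
  have hp1 := hpq.sub_one_pos
  rw [← ENNReal.coe_rpow_of_nonneg _ hp.le, ← ENNReal.coe_rpow_of_nonneg _ hp.le,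
    ← ENNReal.coe_rpow_of_nonneg _ hp1.le, ← ENNReal.coe_rpow_of_nonneg _ hp1.le,
    ENNReal.ofReal, ← ENNReal.coe_sub, ← ENNReal.coe_sub]
  norm_cast
  rw [tsub_le_iff_right, ← NNReal.coe_le_coe]
  have hus : s ^ (p - 1) ≤ u ^ (p - 1) := NNReal.rpow_le_rpow (by exact_mod_cast h) hp1.le
  push_cast [NNReal.coe_sub hus, Real.coe_toNNReal _ hq.le]
  have y := Real.young_inequality_of_nonneg (NNReal.coe_nonneg u)
    (Real.rpow_nonneg (NNReal.coe_nonneg s) (p - 1)) hpq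
  rw [← Real.rpow_mul s.coe_nonneg, hpq.sub_one_mul_conj] at y
  have e : (u : ℝ) * (u : ℝ) ^ (p - 1) = (u : ℝ) ^ p := by
    conv_lhs => rw [← Real.rpow_one_add' u.coe_nonneg (by simpa using hp.ne')]
    ring_nf
  have hqp : q / p = q - 1 := by
    have := hpq.mul_eq_add
    field_simp
    linarith
  have y2 := mul_le_mul_of_nonneg_left y hq.le
  have e2 : q * ((u : ℝ) ^ p / p + (s : ℝ) ^ p / q) = (q / p) * (u : ℝ) ^ p + (s : ℝ) ^ p := by
    field_simp
  rw [e2, hqp] at y2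
  have e3 : q * ((u : ℝ) * ((u : ℝ) ^ (p - 1) - (s : ℝ) ^ (p - 1))) =
      q * (u : ℝ) ^ p - q * ((u : ℝ) * (s : ℝ) ^ (p - 1)) := by rw [← e]; ring
  rw [e3]
  linarith

theorem lavg_congr {μ : Measure (Fin d → ℝ)} {h k : (Fin d → ℝ) → ℝ≥0∞} (hk : h =ᵐ[μ] k) :
    lavg μ h = lavg μ k := by
  funext Q
  rw [lavg, lavg, lintegral_congr_ae (ae_restrict_of_ae hk)]

theorem lpNN_congr {r : ℝ} {μ : Measure (Fin d → ℝ)} {h k : (Fin d → ℝ) → ℝ≥0∞}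
    (hk : h =ᵐ[μ] k) : lpNN r μ h = lpNN r μ k := by
  rw [lpNN, lpNN, lintegral_congr_ae (g := fun x => k x ^ r) (hk.mono fun x hx => by simp only [hx])]

theorem lavg_mul_measure (μ : Measure (Fin d → ℝ)) [IsLocallyFiniteMeasure μ]
    (h : (Fin d → ℝ) → ℝ≥0∞) (Q : DyadicCube d) :
    lavg μ h Q * μ Q = ∫⁻ x in (Q : Set (Fin d → ℝ)), h x ∂μ := by
  rcases eq_or_ne (μ Q) 0 with h0 | h0
  · rw [h0, mul_zero, setLIntegral_measure_zero _ _ h0]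
  · exact ENNReal.div_mul_cancel h0 (measure_cube_lt_top μ Q).ne

/-- Hölder against the indicator of `Q`. -/
theorem lavg_ne_top {p q : ℝ} (hpq : p.HolderConjugate q) {μ : Measure (Fin d → ℝ)}
    [IsLocallyFiniteMeasure μ] {h : (Fin d → ℝ) → ℝ≥0∞} (hh : AEMeasurable h μ)
    (hf : lpNN p μ h ≠ ⊤) (Q : DyadicCube d) : lavg μ h Q ≠ ⊤ := by
  have h1 : ∫⁻ x in (Q : Set (Fin d → ℝ)), h x ∂μ ≠ ⊤ := by
    have key := lintegral_mul_le_lpNN hpq hh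
      (measurable_indicator_cube Q 1).aemeasurable
    have e : ∫⁻ x in (Q : Set (Fin d → ℝ)), h x ∂μ =
        ∫⁻ x, h x * (Q : Set (Fin d → ℝ)).indicator (fun _ => 1) x ∂μ := by
      rw [← lintegral_indicator (measurableSet_cube Q)]
      congr with x
      by_cases hx : x ∈ (Q : Set (Fin d → ℝ)) <;> simp [hx]
    rw [e]
    refine (key.trans_lt (ENNReal.mul_lt_top hf.lt_top ?_)).ne
    refine ENNReal.rpow_lt_top_of_nonneg (by have := hpq.symm.pos; positivity) ?_
    have e2 : ∀ x, (Q : Set (Fin d → ℝ)).indicator (fun _ => (1 : ℝ≥0∞)) x ^ q =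
        (Q : Set (Fin d → ℝ)).indicator (fun _ => 1) x := by
      intro x
      by_cases hx : x ∈ (Q : Set (Fin d → ℝ)) <;> simp [hx, hpq.symm.pos]
    simp_rw [e2]
    rw [lintegral_indicator_const (measurableSet_cube Q), one_mul]
    exact (measure_cube_lt_top μ Q).ne
  rcases eq_or_ne (μ Q) 0 with h0 | h0
  · simp [lavg, setLIntegral_measure_zero _ _ h0]
  · exact ENNReal.div_ne_top h1 h0

/-- Such a `V` is bounded and vanishes off a finite union of cubes of finite measure. -/
theorem lintegral_rpow_ne_top_of_le_sum {r : ℝ} (hr : 0 < r) {μ : Measure (Fin d → ℝ)}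
    [IsLocallyFiniteMeasure μ] (S : Finset (DyadicCube d)) {u : DyadicCube d → ℝ≥0∞}
    (hu : ∀ Q ∈ S, u Q ≠ ⊤) {V : (Fin d → ℝ) → ℝ≥0∞}
    (hV : ∀ x, V x ≤ ∑ Q ∈ S, (Q : Set (Fin d → ℝ)).indicator (fun _ => u Q) x) :
    ∫⁻ x, V x ^ r ∂μ ≠ ⊤ := by
  have hB : ∑ Q ∈ S, u Q ≠ ⊤ := ENNReal.sum_ne_top.mpr hu
  have h1 : ∀ x, V x ^ r ≤ ∑ Q ∈ S,
      (Q : Set (Fin d → ℝ)).indicator (fun _ => (∑ Q ∈ S, u Q) ^ r) x := by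
    intro x
    by_cases hx : ∃ Q ∈ S, x ∈ (Q : Set (Fin d → ℝ))
    · obtain ⟨Q, hQ, hxQ⟩ := hx
      calc V x ^ r ≤ (∑ Q ∈ S, u Q) ^ r := ENNReal.rpow_le_rpow
            ((hV x).trans (Finset.sum_le_sum fun R _ => Set.indicator_le_self _ _ x)) hr.le
        _ = (Q : Set (Fin d → ℝ)).indicator (fun _ => (∑ Q ∈ S, u Q) ^ r) x := by simp [hxQ]
        _ ≤ _ := Finset.single_le_sum (f := fun Q : DyadicCube d =>
            (Q : Set (Fin d → ℝ)).indicator (fun _ => (∑ Q ∈ S, u Q) ^ r) x)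
            (fun _ _ => zero_le) hQ
    · push Not at hx
      have : V x = 0 := le_antisymm ((hV x).trans (Finset.sum_eq_zero fun Q hQ => by
        simp [hx Q hQ]).le) zero_le
      simp [this, hr]
  refine ((lintegral_mono h1).trans_lt ?_).ne
  rw [lintegral_finsetSum _ fun Q _ => measurable_indicator_cube Q _]
  refine ENNReal.sum_lt_top.mpr fun Q _ => ?_
  rw [lintegral_indicator_const (measurableSet_cube Q)]
  exact ENNReal.mul_lt_top (ENNReal.rpow_lt_top_of_nonneg hr.le hB) (measure_cube_lt_top μ Q)

/-! ### Finite maximal functions and the dyadic maximal theorem. -/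

open scoped Classical in
theorem finset_sup_rpow {ι : Type*} (S : Finset ι) (f : ι → ℝ≥0∞) {r : ℝ} (hr : 0 < r) :
    S.sup f ^ r = S.sup fun i => f i ^ r :=
  Finset.apply_sup_eq_sup_comp_of_linearOrder (fun x : ℝ≥0∞ => x ^ r)
    (ENNReal.monotone_rpow_of_nonneg hr.le) (by simp [hr])

open scoped Classical in
/-- The maximum of the coefficients of the cubes of a finite family containing a point. -/
noncomputable def finsetSup (S : Finset (DyadicCube d)) (u : DyadicCube d → ℝ≥0∞)
    (x : Fin d → ℝ) : ℝ≥0∞ :=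
  (S.filter (fun P : DyadicCube d => x ∈ (P : Set (Fin d → ℝ)))).sup u

open scoped Classical in
theorem finsetSup_le_cubeSup (S : Finset (DyadicCube d)) (u : DyadicCube d → ℝ≥0∞)
    (x : Fin d → ℝ) : finsetSup S u x ≤ cubeSup u x :=
  Finset.sup_le fun _ hQ => le_cubeSup u (Finset.mem_filter.mp hQ).2

open scoped Classical in
theorem finsetSup_mono (u : DyadicCube d → ℝ≥0∞) :
    Monotone fun S : Finset (DyadicCube d) => finsetSup S u := fun _ _ h _ =>
  Finset.sup_mono (Finset.filter_subset_filter _ h)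

theorem iSup_finsetSup (u : DyadicCube d → ℝ≥0∞) (x : Fin d → ℝ) :
    ⨆ S, finsetSup S u x = cubeSup u x := by
  refine le_antisymm (iSup_le fun S => finsetSup_le_cubeSup S u x) (iSup_le fun Q => ?_)
  by_cases hx : x ∈ (Q : Set (Fin d → ℝ))
  · rw [Set.indicator_of_mem hx]
    refine le_iSup_of_le {Q} (Finset.le_sup (f := u) ?_)
    simp [hx]
  · simp [hx]

theorem sum_jump_eq_finsetSup (S : Finset (DyadicCube d)) (f : DyadicCube d → ℝ≥0∞)
    (x : Fin d → ℝ) :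
    ∑ P ∈ S, (P : Set (Fin d → ℝ)).indicator (fun _ => jump S f P) x = finsetSup S f x :=
  sum_jump_of_mem S f x

theorem measurable_finsetSup (S : Finset (DyadicCube d)) (u : DyadicCube d → ℝ≥0∞) :
    Measurable (finsetSup S u) := by
  have : finsetSup S u = fun x =>
      ∑ P ∈ S, (P : Set (Fin d → ℝ)).indicator (fun _ => jump S u P) x := by
    funext x; exact (sum_jump_eq_finsetSup S u x).symm
  rw [this]
  exact Finset.measurable_sum _ fun Q _ => measurable_indicator_cube Q _

theorem finsetSup_rpow (S : Finset (DyadicCube d)) (u : DyadicCube d → ℝ≥0∞) {r : ℝ} (hr : 0 < r)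
    (x : Fin d → ℝ) : finsetSup S u x ^ r = finsetSup S (fun Q => u Q ^ r) x :=
  finset_sup_rpow _ u hr

theorem lintegral_mul_sum_indicator {μ : Measure (Fin d → ℝ)} {w : (Fin d → ℝ) → ℝ≥0∞}
    (hw : AEMeasurable w μ) (S : Finset (DyadicCube d)) (a : DyadicCube d → ℝ≥0∞) :
    ∫⁻ x, w x * ∑ P ∈ S, (P : Set (Fin d → ℝ)).indicator (fun _ => a P) x ∂μ =
      ∑ P ∈ S, (∫⁻ x in (P : Set (Fin d → ℝ)), w x ∂μ) * a P := by
  simp_rw [Finset.mul_sum]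
  rw [lintegral_finsetSum' (f := fun (P : DyadicCube d) x =>
    w x * (P : Set (Fin d → ℝ)).indicator (fun _ => a P) x) S
    fun Q _ => hw.mul (measurable_indicator_cube Q _).aemeasurable]
  refine Finset.sum_congr rfl fun P _ => ?_
  have e : ∀ x, w x * (P : Set (Fin d → ℝ)).indicator (fun _ => a P) x =
      (P : Set (Fin d → ℝ)).indicator (fun x => w x * a P) x := by
    intro x
    by_cases hx : x ∈ (P : Set (Fin d → ℝ)) <;> simp [hx]
  simp_rw [e]
  rw [lintegral_indicator (measurableSet_cube P), lintegral_mul_const'' _ hw.restrict]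

theorem sum_lintegral_mul_jump {μ : Measure (Fin d → ℝ)} {w : (Fin d → ℝ) → ℝ≥0∞}
    (hw : AEMeasurable w μ) (S : Finset (DyadicCube d)) (u : DyadicCube d → ℝ≥0∞) :
    ∑ P ∈ S, (∫⁻ x in (P : Set (Fin d → ℝ)), w x ∂μ) * jump S u P =
      ∫⁻ x, w x * finsetSup S u x ∂μ := by
  simp_rw [← sum_jump_eq_finsetSup]
  exact (lintegral_mul_sum_indicator hw S _).symm

/-- The dyadic maximal theorem with respect to a locally finite measure, with constant `p'`. -/
theorem lpNN_cubeSup_lavg_le {p q : ℝ} (hpq : p.HolderConjugate q) {μ : Measure (Fin d → ℝ)}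
    [IsLocallyFiniteMeasure μ] {h : (Fin d → ℝ) → ℝ≥0∞} (hh : AEMeasurable h μ) :
    lpNN p μ (cubeSup (lavg μ h)) ≤ ENNReal.ofReal q * lpNN p μ h := by
  rcases eq_or_ne (lpNN p μ h) ⊤ with ht | ht
  · rw [ht, ENNReal.mul_top (by simpa using hpq.symm.pos)]
    exact le_top
  have hsup : cubeSup (lavg μ h) = fun x => ⨆ S, finsetSup S (lavg μ h) x :=
    funext fun x => (iSup_finsetSup _ x).symm
  rw [hsup]
  refine lpNN_iSup_le hpq.pos (fun S => measurable_finsetSup S _) (finsetSup_mono _) fun S => ?_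
  set u := lavg μ h with hu
  refine lpNN_le_of_lintegral_le hpq
    (lintegral_rpow_ne_top_of_le_sum hpq.pos S (fun Q _ => lavg_ne_top hpq hh ht Q) fun x => ?_) ?_
  · rw [← sum_jump_eq_finsetSup]
    exact Finset.sum_le_sum fun Q _ => Set.indicator_le_indicator tsub_le_self
  have hp1 := hpq.sub_one_pos
  calc ∫⁻ x, finsetSup S u x ^ p ∂μ
      = ∑ P ∈ S, μ P * jump S (fun Q => u Q ^ p) P := by
        have := sum_lintegral_mul_jump (μ := μ) (w := fun _ => 1) aemeasurable_const S
          (fun Q => u Q ^ p)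
        simp only [one_mul, setLIntegral_one] at this
        rw [this]
        simp_rw [finsetSup_rpow S u hpq.pos]
    _ ≤ ∑ P ∈ S, ENNReal.ofReal q * ((∫⁻ x in (P : Set (Fin d → ℝ)), h x ∂μ) *
          jump S (fun Q => u Q ^ (p - 1)) P) := by
        refine Finset.sum_le_sum fun P _ => ?_
        -- Powers commute with finite suprema, so both jumps are differences of powers of the same
        -- pair: `u P` and the supremum over strictly larger cubes.
        rw [jump, jump, ← finset_sup_rpow _ _ hpq.pos, ← finset_sup_rpow _ _ hp1,
          ← lavg_mul_measure μ h P, ← hu]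
        refine (mul_le_mul_right (rpow_sub_rpow_le hpq _ _) _).trans (le_of_eq ?_)
        ring
    _ = ENNReal.ofReal q * ∫⁻ x, h x * finsetSup S u x ^ (p - 1) ∂μ := by
        rw [← Finset.mul_sum, sum_lintegral_mul_jump hh]
        simp_rw [finsetSup_rpow S u hp1]
    _ ≤ ENNReal.ofReal q * (lpNN p μ h * lpNN q μ fun x => finsetSup S u x ^ (p - 1)) :=
        mul_le_mul_right (lintegral_mul_le_lpNN hpq hh
          ((measurable_finsetSup S u).pow_const _).aemeasurable) _
    _ = _ := (mul_assoc _ _ _).symm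

/-! ### Admissible coefficients, norm inequalities and the bilinear form. -/

/-- The total coefficient of the cubes contained in `Q`. -/
noncomputable def subSum (c : DyadicCube d → ℝ≥0∞) (Q : DyadicCube d) : ℝ≥0∞ :=
  ∑' R : {R : DyadicCube d // (R : Set (Fin d → ℝ)) ⊆ Q}, c R

/-- The coefficients `c` are finite and charge no cube that is null for `σ` or for `ω`. -/
structure Admissible (σ ω : Measure (Fin d → ℝ)) (c : DyadicCube d → ℝ≥0∞) : Prop where
  ne_top : ∀ Q, c Q ≠ ⊤
  left : ∀ Q : DyadicCube d, σ Q = 0 → c Q = 0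
  right : ∀ Q : DyadicCube d, ω Q = 0 → c Q = 0

variable {σ ω : Measure (Fin d → ℝ)} {c : DyadicCube d → ℝ≥0∞}

theorem Admissible.symm (hc : Admissible σ ω c) : Admissible ω σ c :=
  ⟨hc.ne_top, hc.right, hc.left⟩

theorem Admissible.subSum_eq_zero (hc : Admissible σ ω c) {Q : DyadicCube d} (h : ω Q = 0) :
    subSum c Q = 0 := by
  simp only [subSum, ENNReal.tsum_eq_zero]
  exact fun R => hc.right R (measure_mono_null R.2 h)

open scoped Classical in
theorem sum_filter_le_subSum (c : DyadicCube d → ℝ≥0∞) (S : Finset (DyadicCube d))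
    (Q : DyadicCube d) : ∑ R ∈ S.filter (· ≤ Q), c R ≤ subSum c Q := by
  have e : subSum c Q = ∑' R : DyadicCube d, {R : DyadicCube d | R ≤ Q}.indicator c R :=
    tsum_subtype {R : DyadicCube d | R ≤ Q} c
  rw [e, Finset.sum_filter]
  exact ENNReal.sum_le_tsum S

/-- The inequality `‖U(a ⟨h⟩^μ)‖_{L^s(ν)} ≤ A ‖h‖_{L^r(μ)}` over extended non-negative `h`. -/
def LavgIneq (r s : ℝ) (μ ν : Measure (Fin d → ℝ))
    (U : (DyadicCube d → ℝ≥0∞) → (Fin d → ℝ) → ℝ≥0∞) (a : DyadicCube d → ℝ≥0∞) (A : ℝ≥0∞) : Prop :=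
  ∀ h : (Fin d → ℝ) → ℝ≥0∞, AEMeasurable h μ → lpNN r μ h ≠ ⊤ →
    lpNN s ν (U fun Q => a Q * lavg μ h Q) ≤ A * lpNN r μ h

theorem eLpNorm_eq_lpNN {ε : Type*} [TopologicalSpace ε] [ContinuousENorm ε] {r : ℝ} (hr : 0 < r)
    (μ : Measure (Fin d → ℝ)) (f : (Fin d → ℝ) → ε) :
    eLpNorm f (ENNReal.ofReal r) μ = lpNN r μ fun x => ‖f x‖ₑ := by
  rw [eLpNorm_eq_lintegral_rpow_enorm_toReal (by simpa using hr) ENNReal.ofReal_ne_top,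
    ENNReal.toReal_ofReal hr.le, lpNN]

theorem lpNN_ae_lt_top {r : ℝ} (hr : 0 < r) {μ : Measure (Fin d → ℝ)}
    {h : (Fin d → ℝ) → ℝ≥0∞} (hh : AEMeasurable h μ) (hf : lpNN r μ h ≠ ⊤) :
    ∀ᵐ x ∂μ, h x < ⊤ := by
  have h1 : ∫⁻ x, h x ^ r ∂μ ≠ ⊤ := by
    intro h2
    rw [lpNN, h2, ENNReal.top_rpow_of_pos (by positivity)] at hf
    exact hf rfl
  filter_upwards [ae_lt_top' (hh.pow_const r) h1] with x hx
  by_contra h3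
  rw [not_lt_top_iff] at h3
  simp [h3, ENNReal.top_rpow_of_pos hr] at hx

/-- A function of finite norm is finite almost everywhere, so `toReal` loses nothing that averages
or norms can see. -/
theorem normIneq_iff_lavgIneq {r s : ℝ} (hr : 0 < r) (hs : 0 < s) (μ ν : Measure (Fin d → ℝ))
    (U : (DyadicCube d → ℝ≥0∞) → (Fin d → ℝ) → ℝ≥0∞) (a : DyadicCube d → ℝ≥0∞) (A : ℝ≥0∞) :
    NormIneq r s μ ν (fun f => U fun Q => a Q * average μ f Q) A ↔ LavgIneq r s μ ν U a A := by
  constructor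
  · intro H h hh hf
    have e : (fun x => ‖(h x).toReal‖ₑ) =ᵐ[μ] h := by
      filter_upwards [lpNN_ae_lt_top hr hh hf] with x hx
      rw [Real.enorm_of_nonneg ENNReal.toReal_nonneg, ENNReal.ofReal_toReal hx.ne]
    have hm : MemLp (fun x => (h x).toReal) (ENNReal.ofReal r) μ := by
      refine ⟨hh.ennreal_toReal.aestronglyMeasurable, ?_⟩
      rw [eLpNorm_eq_lpNN hr, lpNN_congr e]
      exact hf.lt_top
    have key := H _ hm
    rw [eLpNorm_eq_lpNN hr, eLpNorm_eq_lpNN hs, lpNN_congr e] at key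
    rw [← lavg_congr e]
    exact key
  · intro H f hf
    rw [eLpNorm_eq_lpNN hr, eLpNorm_eq_lpNN hs]
    refine H _ hf.1.enorm ?_
    rw [← eLpNorm_eq_lpNN hr]
    exact hf.2.ne

theorem tsum_lintegral_mul {μ : Measure (Fin d → ℝ)} {w : (Fin d → ℝ) → ℝ≥0∞}
    (hw : AEMeasurable w μ) (a : DyadicCube d → ℝ≥0∞) :
    ∫⁻ x, cubeSum a x * w x ∂μ = ∑' P, a P * ∫⁻ x in (P : Set (Fin d → ℝ)), w x ∂μ := by
  simp_rw [cubeSum, ← ENNReal.tsum_mul_right]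
  rw [lintegral_tsum (f := fun (P : DyadicCube d) x =>
    (P : Set (Fin d → ℝ)).indicator (fun _ => a P) x * w x)
    fun Q => (measurable_indicator_cube Q _).aemeasurable.mul hw]
  refine tsum_congr fun P => ?_
  have e : ∀ x, (P : Set (Fin d → ℝ)).indicator (fun _ => a P) x * w x =
      (P : Set (Fin d → ℝ)).indicator (fun x => a P * w x) x := by
    intro x
    by_cases hx : x ∈ (P : Set (Fin d → ℝ)) <;> simp [hx]
  simp_rw [e]
  rw [lintegral_indicator (measurableSet_cube P), lintegral_const_mul'' _ hw.restrict]

/-- The factor `1 / ω Q` moves from the coefficient to the average of `k`, so null cubes need no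
separate treatment. -/
theorem tsum_eq_lintegral_cubeSum (c f : DyadicCube d → ℝ≥0∞) {k : (Fin d → ℝ) → ℝ≥0∞} (hk : AEMeasurable k ω) :
    ∫⁻ x, cubeSum (fun Q => c Q / ω Q * f Q) x * k x ∂ω = ∑' Q, c Q * (f Q * lavg ω k Q) := by
  rw [tsum_lintegral_mul hk]
  refine tsum_congr fun Q => ?_
  simp only [lavg, div_eq_mul_inv]
  ring

/-- The bilinear form estimate associated with the summation operator. -/
def BilinIneq (p q : ℝ) (σ ω : Measure (Fin d → ℝ)) (c : DyadicCube d → ℝ≥0∞) (A : ℝ≥0∞) : Prop :=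
  ∀ h k : (Fin d → ℝ) → ℝ≥0∞, AEMeasurable h σ → AEMeasurable k ω → lpNN p σ h ≠ ⊤ →
    lpNN q ω k ≠ ⊤ →
    ∑' Q, c Q * (lavg σ h Q * lavg ω k Q) ≤ A * (lpNN p σ h * lpNN q ω k)

theorem BilinIneq.symm {p q : ℝ} {A : ℝ≥0∞} (H : BilinIneq p q σ ω c A) :
    BilinIneq q p ω σ c A := by
  intro h k hh hk hf hg
  have := H k h hk hh hg hf
  simpa only [mul_comm (lavg σ k _), mul_comm (lpNN p σ k)] using this

theorem bilinIneq_of_lavgIneq {p q q' : ℝ} (hq : q.HolderConjugate q')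
    {A : ℝ≥0∞} (H : LavgIneq p q σ ω cubeSum (fun Q => c Q / ω Q) A) : BilinIneq p q' σ ω c A := by
  intro h k hh hk hf hg
  rw [← tsum_eq_lintegral_cubeSum c _ hk]
  refine (lintegral_mul_le_lpNN hq (measurable_cubeSum _).aemeasurable hk).trans ?_
  rw [← mul_assoc]
  exact mul_le_mul_left (H h hh hf) _

-- Duality with the explicit extremal test function `V ^ (q - 1)`, where `V` is a finite partial sum
-- and so has finite `L^q` norm; monotone convergence then removes the truncation.
open scoped Classical in
theorem lavgIneq_of_bilinIneq [IsLocallyFiniteMeasure σ] [IsLocallyFiniteMeasure ω]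
    {p p' q q' : ℝ} (hp : p.HolderConjugate p') (hq : q.HolderConjugate q')
    (hc : Admissible σ ω c) {A : ℝ≥0∞}
    (H : BilinIneq p q' σ ω c A) : LavgIneq p q σ ω cubeSum (fun Q => c Q / ω Q) A := by
  intro h hh hf
  set u : DyadicCube d → ℝ≥0∞ := fun Q => c Q / ω Q * lavg σ h Q with hu
  have hut : ∀ Q, u Q ≠ ⊤ := by
    intro Q
    refine ENNReal.mul_ne_top ?_ (lavg_ne_top hp hh hf Q)
    rcases eq_or_ne (ω Q) 0 with h0 | h0
    · simp [hc.right Q h0]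
    · exact ENNReal.div_ne_top (hc.ne_top Q) h0
  let V : Finset (DyadicCube d) → (Fin d → ℝ) → ℝ≥0∞ := fun S x =>
    ∑ Q ∈ S, (Q : Set (Fin d → ℝ)).indicator (fun _ => u Q) x
  have hVm : ∀ S, Measurable (V S) := fun S =>
    Finset.measurable_sum _ fun Q _ => measurable_indicator_cube Q _
  have hsum : cubeSum u = fun x => ⨆ S, V S x := funext fun x => ENNReal.tsum_eq_iSup_sum
  rw [hsum]
  refine lpNN_iSup_le hq.pos hVm (fun S S' hS x => Finset.sum_le_sum_of_subset hS) fun S => ?_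
  have hI := lintegral_rpow_ne_top_of_le_sum (μ := ω) (V := V S) hq.pos S
    (fun Q _ => hut Q) fun x => le_rfl
  have hk : Measurable fun x => V S x ^ (q - 1) := (hVm S).pow_const _
  refine lpNN_le_of_lintegral_le hq hI ?_
  calc ∫⁻ x, V S x ^ q ∂ω = ∫⁻ x, V S x * V S x ^ (q - 1) ∂ω := by
        congr with x
        nth_rewrite 2 [← ENNReal.rpow_one (V S x)]
        rw [← ENNReal.rpow_add_of_nonneg _ _ zero_le_one hq.sub_one_pos.le]
        ring_nf
    _ ≤ ∫⁻ x, cubeSum u x * V S x ^ (q - 1) ∂ω :=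
        lintegral_mono fun x => mul_le_mul_left (ENNReal.sum_le_tsum S) _
    _ = ∑' Q, c Q * (lavg σ h Q * lavg ω (fun x => V S x ^ (q - 1)) Q) :=
        tsum_eq_lintegral_cubeSum c _ hk.aemeasurable
    _ ≤ A * (lpNN p σ h * lpNN q' ω fun x => V S x ^ (q - 1)) := by
        refine H _ _ hh hk.aemeasurable hf ?_
        rw [lpNN_rpow_sub_one hq]
        exact ENNReal.rpow_ne_top_of_nonneg (by have := hq.symm.pos; positivity) hI
    _ = _ := (mul_assoc _ _ _).symm

/-! ### Maximal bounds imply the bilinear bound. -/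

theorem le_lavg {μ : Measure (Fin d → ℝ)} [IsLocallyFiniteMeasure μ] {Q : DyadicCube d}
    (h0 : μ Q ≠ 0) {b : ℝ≥0∞} {h : (Fin d → ℝ) → ℝ≥0∞}
    (hb : ∀ x ∈ (Q : Set (Fin d → ℝ)), b ≤ h x) : b ≤ lavg μ h Q := by
  rw [lavg, ENNReal.le_div_iff_mul_le (Or.inl h0) (Or.inl (measure_cube_lt_top μ Q).ne),
    ← setLIntegral_const]
  exact setLIntegral_mono' (measurableSet_cube Q) hb

-- On `P` the function `cubeSup (lavg σ h)` dominates every average of `h` over a larger cube, so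
-- its own average over `P` does too. If `P` is null for either measure, `subSum c P` vanishes.
open scoped Classical in
theorem subSum_mul_sup_le [IsLocallyFiniteMeasure σ] [IsLocallyFiniteMeasure ω]
    (hc : Admissible σ ω c) (h : (Fin d → ℝ) → ℝ≥0∞) (S : Finset (DyadicCube d))
    (P : DyadicCube d) :
    subSum c P * (S.filter (P ≤ ·)).sup (lavg σ h) ≤ ∫⁻ x in (P : Set (Fin d → ℝ)),
      cubeSup (fun Q => subSum c Q / ω Q * lavg σ (cubeSup (lavg σ h)) Q) x ∂ω := by
  rcases eq_or_ne (σ P) 0 with hσ | hσ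
  · simp [hc.symm.subSum_eq_zero hσ]
  rcases eq_or_ne (ω P) 0 with hω | hω
  · simp [hc.subSum_eq_zero hω]
  have h1 : (S.filter (P ≤ ·)).sup (lavg σ h) ≤ lavg σ (cubeSup (lavg σ h)) P :=
    le_lavg hσ fun x hx => Finset.sup_le fun Q hQ =>
      le_cubeSup _ ((Finset.mem_filter.mp hQ).2 hx)
  calc subSum c P * (S.filter (P ≤ ·)).sup (lavg σ h)
      ≤ subSum c P * lavg σ (cubeSup (lavg σ h)) P := mul_le_mul_right h1 _
    _ = subSum c P / ω P * lavg σ (cubeSup (lavg σ h)) P * ω P := by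
        rw [mul_right_comm, ENNReal.div_mul_cancel hω (measure_cube_lt_top ω P).ne]
    _ ≤ _ := by
        rw [← setLIntegral_const]
        exact setLIntegral_mono' (measurableSet_cube P) fun x hx =>
          le_cubeSup (fun Q => subSum c Q / ω Q * lavg σ (cubeSup (lavg σ h)) Q) hx

theorem lpNN_cubeSup_lavg_ne_top {p p' : ℝ} (hp : p.HolderConjugate p')
    [IsLocallyFiniteMeasure σ] {h : (Fin d → ℝ) → ℝ≥0∞} (hh : AEMeasurable h σ)
    (hf : lpNN p σ h ≠ ⊤) : lpNN p σ (cubeSup (lavg σ h)) ≠ ⊤ :=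
  ((lpNN_cubeSup_lavg_le hp hh).trans_lt (ENNReal.mul_lt_top ENNReal.ofReal_lt_top hf.lt_top)).ne

-- One half of the split form. The maximal theorem costs `p'` on `L^p(σ)` and `q`, the conjugate of
-- `q'`, on `L^{q'}(ω)`.
open scoped Classical in
theorem sum_subSum_mul_le [IsLocallyFiniteMeasure σ] [IsLocallyFiniteMeasure ω]
    {p p' q q' : ℝ} (hp : p.HolderConjugate p') (hq : q.HolderConjugate q')
    (hc : Admissible σ ω c) {A : ℝ≥0∞}
    (H : LavgIneq p q σ ω cubeSup (fun Q => subSum c Q / ω Q) A)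
    {h k : (Fin d → ℝ) → ℝ≥0∞} (hh : AEMeasurable h σ) (hk : AEMeasurable k ω)
    (hf : lpNN p σ h ≠ ⊤) (S : Finset (DyadicCube d)) :
    ∑ P ∈ S, subSum c P * ((S.filter (P ≤ ·)).sup (lavg σ h) * jump S (lavg ω k) P) ≤
      ENNReal.ofReal (p' * q) * A * (lpNN p σ h * lpNN q' ω k) := by
  set w : (Fin d → ℝ) → ℝ≥0∞ :=
    cubeSup fun Q => subSum c Q / ω Q * lavg σ (cubeSup (lavg σ h)) Q with hw
  have hwm : AEMeasurable w ω := (measurable_cubeSup _).aemeasurable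
  calc ∑ P ∈ S, subSum c P * ((S.filter (P ≤ ·)).sup (lavg σ h) * jump S (lavg ω k) P)
      ≤ ∑ P ∈ S, (∫⁻ x in (P : Set (Fin d → ℝ)), w x ∂ω) * jump S (lavg ω k) P := by
        refine Finset.sum_le_sum fun P _ => ?_
        rw [← mul_assoc]
        exact mul_le_mul_left (subSum_mul_sup_le hc h S P) _
    _ = ∫⁻ x, w x * finsetSup S (lavg ω k) x ∂ω := sum_lintegral_mul_jump hwm S _
    _ ≤ ∫⁻ x, w x * cubeSup (lavg ω k) x ∂ω :=
        lintegral_mono fun x => mul_le_mul_right (finsetSup_le_cubeSup S _ x) _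
    _ ≤ lpNN q ω w * lpNN q' ω (cubeSup (lavg ω k)) :=
        lintegral_mul_le_lpNN hq hwm (measurable_cubeSup _).aemeasurable
    _ ≤ A * (ENNReal.ofReal p' * lpNN p σ h) * (ENNReal.ofReal q * lpNN q' ω k) := by
        refine mul_le_mul' ((H _ (measurable_cubeSup _).aemeasurable
          (lpNN_cubeSup_lavg_ne_top hp hh hf)).trans ?_) (lpNN_cubeSup_lavg_le hq.symm hk)
        exact mul_le_mul_right (lpNN_cubeSup_lavg_le hp hh) _
    _ = _ := by
        rw [ENNReal.ofReal_mul hp.symm.nonneg]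
        ring

/-- Bounds for both maximal operators imply the bilinear form estimate. -/
theorem bilinIneq_of_cubeSup [IsLocallyFiniteMeasure σ] [IsLocallyFiniteMeasure ω]
    {p p' q q' : ℝ} (hp : p.HolderConjugate p') (hq : q.HolderConjugate q')
    (hc : Admissible σ ω c) {A B : ℝ≥0∞}
    (HA : LavgIneq p q σ ω cubeSup (fun Q => subSum c Q / ω Q) A)
    (HB : LavgIneq q' p' ω σ cubeSup (fun Q => subSum c Q / σ Q) B) :
    BilinIneq p q' σ ω c (ENNReal.ofReal (p' * q) * (A + B)) := by
  classical
  intro h k hh hk hf hg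
  rw [ENNReal.tsum_eq_iSup_sum]
  refine iSup_le fun S => (sum_mul_le_sum_jump S c _ _).trans ?_
  have h1 := sum_subSum_mul_le hp hq hc HA hh hk hf S
  -- The other half is the same estimate with the two measures and their exponents exchanged.
  have h2 := sum_subSum_mul_le hq.symm hp.symm hc.symm HB hk hh hg S
  calc _ ≤ ∑ P ∈ S, subSum c P * (jump S (lavg σ h) P * (S.filter (P ≤ ·)).sup (lavg ω k) +
          (S.filter (P ≤ ·)).sup (lavg σ h) * jump S (lavg ω k) P) :=
        Finset.sum_le_sum fun P _ => mul_le_mul_left (sum_filter_le_subSum c S P) _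
    _ = ∑ P ∈ S, subSum c P * ((S.filter (P ≤ ·)).sup (lavg σ h) * jump S (lavg ω k) P) +
          ∑ P ∈ S, subSum c P * ((S.filter (P ≤ ·)).sup (lavg ω k) * jump S (lavg σ h) P) := by
        rw [← Finset.sum_add_distrib]
        refine Finset.sum_congr rfl fun P _ => ?_
        ring
    _ ≤ _ := add_le_add h1 h2
    _ = _ := by
        rw [mul_comm q p', mul_comm (lpNN q' ω k)]
        ring

/-! ### The summation bound implies the maximal bounds. -/

/-- A bound for the summation operator implies one for the associated maximal operator. -/
theorem lavgIneq_cubeSup_of_cubeSum [IsLocallyFiniteMeasure σ] [IsLocallyFiniteMeasure ω]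
    {p p' q q' : ℝ} (hp : p.HolderConjugate p') (hq : q.HolderConjugate q')
    (hc : Admissible σ ω c) {A : ℝ≥0∞}
    (H : LavgIneq p q σ ω cubeSum (fun Q => c Q / ω Q) A) :
    LavgIneq p q σ ω cubeSup (fun Q => subSum c Q / ω Q) (ENNReal.ofReal (q' * p') * A) := by
  intro h hh hf
  set M := cubeSup (lavg σ h) with hM
  set T := cubeSum fun Q => c Q / ω Q * lavg σ M Q with hT
  have hTm : AEMeasurable T ω := (measurable_cubeSum _).aemeasurable
  have hpt : ∀ Q, subSum c Q / ω Q * lavg σ h Q ≤ lavg ω T Q := by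
    intro Q
    rw [mul_comm, ← mul_div_assoc, mul_comm, lavg]
    refine ENNReal.div_le_div_right ?_ _
    have e : ∫⁻ x in (Q : Set (Fin d → ℝ)), T x ∂ω =
        ∫⁻ x, T x * (Q : Set (Fin d → ℝ)).indicator (fun _ => 1) x ∂ω := by
      rw [← lintegral_indicator (measurableSet_cube Q)]
      congr with x
      by_cases hx : x ∈ (Q : Set (Fin d → ℝ)) <;> simp [hx]
    rw [e, tsum_eq_lintegral_cubeSum c _ (measurable_indicator_cube Q 1).aemeasurable, subSum,
      ← ENNReal.tsum_mul_right]
    refine le_trans (ENNReal.tsum_le_tsum fun R => ?_) (ENNReal.tsum_comp_le_tsum_of_injective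
      (Subtype.val_injective (p := fun R : DyadicCube d => (R : Set (Fin d → ℝ)) ⊆ Q)) _)
    -- On null cubes averages are zero by convention and bound nothing; admissibility makes these
    -- terms vanish.
    rcases eq_or_ne (σ (R : DyadicCube d)) 0 with hσ | hσ
    · simp [hc.left _ hσ]
    rcases eq_or_ne (ω (R : DyadicCube d)) 0 with hω | hω
    · simp [hc.right _ hω]
    refine mul_le_mul_right ?_ _
    change lavg σ h Q ≤ _
    rw [← mul_one (lavg σ h Q)]
    refine mul_le_mul' (le_lavg hσ fun x hx => le_cubeSup _ (R.2 hx)) (le_lavg hω fun x hx => ?_)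
    rw [Set.indicator_of_mem (R.2 hx)]
  calc lpNN q ω (cubeSup fun Q => subSum c Q / ω Q * lavg σ h Q)
      ≤ lpNN q ω (cubeSup (lavg ω T)) :=
        lpNN_mono hq.pos fun x => iSup_mono fun Q => Set.indicator_le_indicator (hpt Q)
    _ ≤ ENNReal.ofReal q' * lpNN q ω T := lpNN_cubeSup_lavg_le hq hTm
    _ ≤ ENNReal.ofReal q' * (A * (ENNReal.ofReal p' * lpNN p σ h)) := by
        refine mul_le_mul_right ((H M (measurable_cubeSup _).aemeasurable
          (lpNN_cubeSup_lavg_ne_top hp hh hf)).trans ?_) _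
        exact mul_le_mul_right (lpNN_cubeSup_lavg_le hp hh) _
    _ = _ := by
        rw [ENNReal.ofReal_mul hq.symm.nonneg]
        ring

/-! ### Operator norms and the two-sided estimate. -/

/-- The infimum is attained, since multiplication by the finite norm of `f` commutes with it. -/
theorem NormIneq.opNorm {r s : ℝ} {μ ν : Measure (Fin d → ℝ)}
    {T : ((Fin d → ℝ) → ℝ) → (Fin d → ℝ) → ℝ≥0∞} (h : opNorm r s μ ν T ≠ ⊤) :
    NormIneq r s μ ν T (opNorm r s μ ν T) := by
  intro f hf
  have hne : {C : ℝ≥0∞ | NormIneq r s μ ν T C}.Nonempty := by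
    by_contra h0
    exact h (by rw [TwoWeight.opNorm, Set.not_nonempty_iff_eq_empty.mp h0, sInf_empty])
  have : Nonempty {C : ℝ≥0∞ | NormIneq r s μ ν T C} := hne.to_subtype
  rw [TwoWeight.opNorm, sInf_eq_iInf', ENNReal.iInf_mul fun h => absurd h hf.2.ne]
  exact le_iInf fun C => C.2 f hf

theorem exists_normIneq_iff {r s : ℝ} {μ ν : Measure (Fin d → ℝ)}
    {T : ((Fin d → ℝ) → ℝ) → (Fin d → ℝ) → ℝ≥0∞} :
    (∃ A : ℝ≥0, NormIneq r s μ ν T A) ↔ opNorm r s μ ν T ≠ ⊤ := by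
  refine ⟨fun ⟨A, hA⟩ => ((sInf_le hA).trans_lt ENNReal.coe_lt_top).ne, fun h => ?_⟩
  refine ⟨(opNorm r s μ ν T).toNNReal, ?_⟩
  rw [ENNReal.coe_toNNReal h]
  exact NormIneq.opNorm h

/-- There are countably many cubes, so the `ω`-null ones have a null union. This lets `l Q` be
replaced by `c Q / ω Q`. -/
theorem cubeSum_ae_congr {a b : DyadicCube d → ℝ≥0∞} (hab : ∀ Q : DyadicCube d, ω Q ≠ 0 → a Q = b Q) :
    cubeSum a =ᵐ[ω] cubeSum b := by
  have h : ∀ᵐ x ∂ω, ∀ Q : DyadicCube d, x ∈ (Q : Set (Fin d → ℝ)) → a Q = b Q := by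
    rw [ae_all_iff]
    intro Q
    by_cases h0 : ω Q = 0
    · filter_upwards [measure_eq_zero_iff_ae_notMem.mp h0] with x hx hx'
      exact absurd hx' hx
    · exact Filter.Eventually.of_forall fun x _ => hab Q h0
  filter_upwards [h] with x hx
  refine tsum_congr fun Q => ?_
  by_cases hQ : x ∈ (Q : Set (Fin d → ℝ))
  · simp [hQ, hx Q hQ]
  · simp [hQ]

end TwoWeight

open TwoWeight in
theorem proposition2p3 (p q : ℝ) (hq : 1 < q) (hqp : q < p) :
    ∃ C : ℝ≥0, ∀ (d : ℕ) (_ : 0 < d) (σ ω : Measure (Fin d → ℝ))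
      (_ : IsLocallyFiniteMeasure σ) (_ : IsLocallyFiniteMeasure ω)
      (l : TwoWeight.DyadicCube d → ℝ≥0)
      (_ : ∀ Q : TwoWeight.DyadicCube d, σ Q = 0 → ω Q = 0 ∨ l Q = 0),
      TwoWeight.opNorm p q σ ω (TwoWeight.sumOp (fun Q => (l Q : ℝ≥0∞)) σ) ≤
        C * (TwoWeight.opNorm p q σ ω (TwoWeight.maxOp (TwoWeight.bigLambda l ω) σ) +
          TwoWeight.opNorm (q / (q - 1)) (p / (p - 1)) ω σ
            (TwoWeight.maxOp (fun Q => ω Q / σ Q * TwoWeight.bigLambda l ω Q) ω)) ∧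
      TwoWeight.opNorm p q σ ω (TwoWeight.maxOp (TwoWeight.bigLambda l ω) σ) +
          TwoWeight.opNorm (q / (q - 1)) (p / (p - 1)) ω σ
            (TwoWeight.maxOp (fun Q => ω Q / σ Q * TwoWeight.bigLambda l ω Q) ω) ≤
        C * TwoWeight.opNorm p q σ ω (TwoWeight.sumOp (fun Q => (l Q : ℝ≥0∞)) σ) ∧
      ((∃ A : ℝ≥0, TwoWeight.NormIneq p q σ ω
          (TwoWeight.sumOp (fun Q => (l Q : ℝ≥0∞)) σ) A) ↔
        (∃ A : ℝ≥0, TwoWeight.NormIneq p q σ ω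
          (TwoWeight.maxOp (TwoWeight.bigLambda l ω) σ) A) ∧
        (∃ A : ℝ≥0, TwoWeight.NormIneq (q / (q - 1)) (p / (p - 1)) ω σ
          (TwoWeight.maxOp (fun Q => ω Q / σ Q * TwoWeight.bigLambda l ω Q) ω) A)) := by
  have hp : p.HolderConjugate (p / (p - 1)) := Real.HolderConjugate.conjExponent (hq.trans hqp)
  have hq : q.HolderConjugate (q / (q - 1)) := Real.HolderConjugate.conjExponent hq
  set p' := p / (p - 1)
  set q' := q / (q - 1)
  have hp0 := hp.pos
  have hp0' := hp.symm.pos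
  have hq0 := hq.pos
  have hq0' := hq.symm.pos
  -- `p' * q` serves the upper bound; `q' * p'` and `p * q` serve the two maximal operators in the
  -- lower one.
  refine ⟨(p' * q).toNNReal + ((q' * p').toNNReal + (p * q).toNNReal), ?_⟩
  intro d _ σ ω _ _ l hl
  set C : ℝ≥0 := (p' * q).toNNReal + ((q' * p').toNNReal + (p * q).toNNReal) with hC
  -- Needed for `C * ⊤ = ⊤` when a norm on the right is infinite.
  have hC0 : (C : ℝ≥0∞) ≠ 0 := by
    have : 0 < (p' * q).toNNReal := Real.toNNReal_pos.mpr (by positivity)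
    exact_mod_cast (this.trans_le le_self_add).ne'
  have hC1 : ENNReal.ofReal (p' * q) ≤ C := by
    simp only [ENNReal.ofReal]
    exact_mod_cast le_self_add
  have hC2 : ENNReal.ofReal (q' * p') + ENNReal.ofReal (p * q) ≤ C := by
    simp only [ENNReal.ofReal]
    exact_mod_cast le_add_self
  let c : DyadicCube d → ℝ≥0∞ := fun Q => (l Q : ℝ≥0∞) * ω Q
  have hc : Admissible σ ω c := by
    refine ⟨fun Q => ENNReal.mul_ne_top ENNReal.coe_ne_top (measure_cube_lt_top ω Q).ne,
      fun Q h => ?_, fun Q h => by simp [c, h]⟩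
    rcases hl Q h with h | h <;> simp [c, h]
  have eT : ∀ A, NormIneq p q σ ω (sumOp (fun Q => (l Q : ℝ≥0∞)) σ) A ↔
      LavgIneq p q σ ω cubeSum (fun Q => c Q / ω Q) A := by
    intro A
    have e0 : sumOp (fun Q => (l Q : ℝ≥0∞)) σ =
      fun f => cubeSum fun Q => (l Q : ℝ≥0∞) * average σ f Q := rfl
    rw [e0, normIneq_iff_lavgIneq hp0 hq0]
    refine forall_congr' fun h => ?_
    have e : cubeSum (fun Q => (l Q : ℝ≥0∞) * lavg σ h Q) =ᵐ[ω]
        cubeSum fun Q => c Q / ω Q * lavg σ h Q :=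
      cubeSum_ae_congr fun Q hQ => by
        rw [ENNReal.mul_div_cancel_right hQ (measure_cube_lt_top ω Q).ne]
    rw [lpNN_congr e]
  have eM : ∀ A, NormIneq p q σ ω (maxOp (bigLambda l ω) σ) A ↔
      LavgIneq p q σ ω cubeSup (fun Q => subSum c Q / ω Q) A := fun A =>
    normIneq_iff_lavgIneq hp0 hq0 σ ω cubeSup (bigLambda l ω) A
  have eN : ∀ A, NormIneq q' p' ω σ (maxOp (fun Q => ω Q / σ Q * bigLambda l ω Q) ω) A ↔
      LavgIneq q' p' ω σ cubeSup (fun Q => subSum c Q / σ Q) A := by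
    intro A
    have e : (fun Q => subSum c Q / σ Q) = fun Q : DyadicCube d => ω Q / σ Q * bigLambda l ω Q := by
      funext Q
      have e1 : bigLambda l ω Q = subSum c Q / ω Q := rfl
      rw [e1]
      rcases eq_or_ne (ω Q) 0 with h0 | h0
      · simp [hc.subSum_eq_zero h0]
      · rw [mul_comm, ← mul_div_assoc, ENNReal.div_mul_cancel h0 (measure_cube_lt_top ω Q).ne]
    rw [e]
    exact normIneq_iff_lavgIneq hq0' hp0' ω σ cubeSup _ A
  set NT := opNorm p q σ ω (sumOp (fun Q => (l Q : ℝ≥0∞)) σ) with hNT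
  set NM := opNorm p q σ ω (maxOp (bigLambda l ω) σ) with hNM
  set NN := opNorm q' p' ω σ (maxOp (fun Q => ω Q / σ Q * bigLambda l ω Q) ω) with hNN
  have hupper : NT ≤ C * (NM + NN) := by
    rcases eq_or_ne NM ⊤ with h1 | h1
    · simp [h1, hC0]
    rcases eq_or_ne NN ⊤ with h2 | h2
    · simp [h2, hC0]
    have k1 := (eM _).mp (NormIneq.opNorm h1)
    have k2 := (eN _).mp (NormIneq.opNorm h2)
    exact (sInf_le ((eT _).mpr (lavgIneq_of_bilinIneq hp hq hc
      (bilinIneq_of_cubeSup hp hq hc k1 k2)))).trans (mul_le_mul_left hC1 _)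
  have hlower : NM + NN ≤ C * NT := by
    rcases eq_or_ne NT ⊤ with h1 | h1
    · simp [h1, hC0]
    have k := (eT _).mp (NormIneq.opNorm h1)
    -- Passing through the symmetric form gives the bound for the adjoint summation operator, from
    -- `L^{q'}(ω)` to `L^{p'}(σ)`.
    have k' := lavgIneq_of_bilinIneq hq.symm hp.symm hc.symm (bilinIneq_of_lavgIneq hq k).symm
    have j1 : NM ≤ _ := sInf_le ((eM _).mpr (lavgIneq_cubeSup_of_cubeSum hp hq hc k))
    have j2 : NN ≤ _ :=
      sInf_le ((eN _).mpr (lavgIneq_cubeSup_of_cubeSum hq.symm hp.symm hc.symm k'))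
    refine (add_le_add j1 j2).trans ?_
    rw [← add_mul]
    exact mul_le_mul_left hC2 _
  refine ⟨hupper, hlower, ?_⟩
  rw [exists_normIneq_iff, exists_normIneq_iff, exists_normIneq_iff]
  constructor
  · intro h
    have := hlower.trans_lt (ENNReal.mul_lt_top ENNReal.coe_lt_top h.lt_top)
    exact ⟨(le_self_add.trans_lt this).ne, (le_add_self.trans_lt this).ne⟩
  · rintro ⟨h1, h2⟩
    exact (hupper.trans_lt (ENNReal.mul_lt_top ENNReal.coe_lt_top
      (ENNReal.add_lt_top.mpr ⟨h1.lt_top, h2.lt_top⟩))).ne
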